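/- Consider the unilateral network creation game with link price $\alpha>0$ on a connected host graph $G=(V,E)$ with $|V|=n$. A strategy of player $i\in V$ is a set $s_i\subseteq\{j:\{i,j\}\in E\}$; the joint strategy $s=(s_i)_{i\in V}$ creates the graph $G_s$ on $V$ with an edge $\{i,j\}$ whenever $j\in s_i$ or $i\in s_j$. The cost of player $i$ is $c_i(s)=\alpha|s_i|+\sum_{j\in V}d_{G_s}(i,j)$ (with $d_{G_s}(i,j)=\infty$ if $i$ and $j$ are not connected in $G_s$), and the total cost is $c(s)=\sum_i c_i(s)$. A (pure) Nash equilibrium is a joint strategy $s$ such that $c_i(s)\le c_i(s')$ for every player $i$ and every joint strategy $s'$ that differs from $s$ only in the strategy of player $i$. The price of anarchy $\mathrm{PoA}_\alpha(G)$ is the maximum of $c(s)$ over the Nash equilibria $s$ with $G_s$ connected (equivalently, of finite cost), divided by the minimum of $c(s')$ over all joint strategies $s'$ (it is read as $0$ if there is no such equilibrium). Theorem. The price of anarchy of the unilateral game on general host graphs is $\Omega(\min\{\alpha/n,\,n^2/\alpha\})$. That is, there is an absolute constant $c>0$ such that for every integer $n\ge 2$ and every real $\alpha>0$ there is a connected host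 graph $G$ on $n$ vertices with $$\mathrm{PoA}_\alpha(G)\ \ge\ c\cdot\min\Big\{\frac{\alpha}{n},\frac{n^2}{\alpha}\Big\}.$$ -/

import Mathlib

open scoped ENNReal

namespace NetworkCreation

variable {V : Type*}

/-- A joint strategy of the unilateral network creation game on the host graph `G`: player `i`
buys links to a set `buys i` of neighbours of `i` in `G`. -/
structure JointStrategy (G : SimpleGraph V) where
  buys : V → Finset V
  adj_of_mem : ∀ i j, j ∈ buys i → G.Adj i j

namespace JointStrategy

variable {G : SimpleGraph V}

/-- The created network: `{i, j}` is a link if `i` or `j` buys it. -/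
def network (s : JointStrategy G) : SimpleGraph V where
  Adj i j := j ∈ s.buys i ∨ i ∈ s.buys j
  symm := ⟨fun _ _ h => h.symm⟩
  loopless := ⟨fun i h => G.loopless.irrefl i (h.elim (s.adj_of_mem i i) (s.adj_of_mem i i))⟩

variable [Fintype V]

/-- The cost of player `i`: link price times number of links bought by `i`, plus the sum of the
distances from `i` in the created network (the distance of unreachable vertices is `∞`). -/
noncomputable def playerCost (α : ℝ) (s : JointStrategy G) (i : V) : ℝ≥0∞ :=
  ENNReal.ofReal α * ((s.buys i).card : ℝ≥0∞) + ∑ j, (s.network.edist i j : ℝ≥0∞)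

/-- The total cost of a joint strategy. -/
noncomputable def totalCost (α : ℝ) (s : JointStrategy G) : ℝ≥0∞ :=
  ∑ i, s.playerCost α i

/-- Pure Nash equilibria: no player can lower its own cost by changing its own strategy. -/
def IsNash (α : ℝ) (s : JointStrategy G) : Prop :=
  ∀ (i : V) (t : JointStrategy G), (∀ j, j ≠ i → t.buys j = s.buys j) →
    s.playerCost α i ≤ t.playerCost α i

end JointStrategy

variable [Fintype V]

/-- The social optimum: the minimum total cost of a joint strategy on the host graph `G`. -/
noncomputable def socialOptimum (α : ℝ) (G : SimpleGraph V) : ℝ≥0∞ :=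
  ⨅ s : JointStrategy G, s.totalCost α

/-- The price of anarchy on the host graph `G`: the largest total cost of a Nash equilibrium
divided by the social optimum. Only equilibria whose network is connected, that is those of finite
cost, are counted; otherwise degenerate equilibria such as the empty network, in which no player
alone can make its own cost finite, would make the ratio infinite. The supremum is over finitely
many values, and it is `0` if there is no such equilibrium. -/
noncomputable def priceOfAnarchy (α : ℝ) (G : SimpleGraph V) : ℝ≥0∞ :=
  ⨆ (s : JointStrategy G) (_ : s.IsNash α) (_ : s.network.Connected),
    s.totalCost α / socialOptimum α G

end NetworkCreation

/-! The host is a path on `n` vertices plus chords joining consecutive multiples of `k = ⌊α/n⌋ + 1`.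
The bare path is an equilibrium (`pathStrategy_isNash`) when multiples of `k` buy nothing and every
link has a single buyer: a non-multiple has only path links available, and dropping one disconnects
it; a multiple may buy chords, but these shorten each of its `n` distances by at most `k - 1`, and
`n(k - 1) ≤ α`. The path costs at least `n³/4`, its distance sum. Buying the whole host costs `O(αn
+ n²(k + n/k)) = O(αn + n⁴/α)` for `α ≥ n`, and the quotient of the two is of order `min(α/n,
n²/α)`. For `α < n` that minimum is below 1, so any equilibrium suffices. -/

namespace SimpleGraph

/-! ### Distance bounds and the distance sum of a path -/

variable {V : Type*} {G : SimpleGraph V}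

/-- A function that vanishes at `i` and grows by at most one along each edge bounds the distance
from `i` from below. -/
theorem le_edist_of_le_add_one (g : V → ℕ∞) {i : V} (hi : g i = 0)
    (hg : ∀ x y, G.Adj x y → g y ≤ g x + 1) (j : V) : g j ≤ G.edist i j := by
  have key : ∀ {x y : V} (w : G.Walk x y), g y ≤ g x + w.length := by
    intro x y w
    induction w with
    | nil => simp
    | @cons u v w h p ih =>
      calc g w ≤ g v + p.length := ih
        _ ≤ g u + 1 + p.length := by gcongr; exact hg _ _ h
        _ = g u + (Walk.cons h p).length := by
          rw [Walk.length_cons]; push_cast; rw [add_assoc, add_comm 1]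
  refine le_iInf fun w => ?_
  simpa [hi] using key w

/-- Used with `l = 1` for walks along the path and with `l = k` for walks along the chords. -/
theorem edist_add_mul_le {n : ℕ} {G : SimpleGraph (Fin n)} {l : ℕ}
    (hG : ∀ x y : Fin n, l ∣ x → (x : ℕ) + l = y → G.Adj x y) {a : ℕ} (ha : l ∣ a) :
    ∀ (m : ℕ) (h₀ : a < n) (h : a + m * l < n), G.edist ⟨a, h₀⟩ ⟨a + m * l, h⟩ ≤ m := by
  intro m
  induction m with
  | zero => intro h₀ h; simp
  | succ m ih =>
    intro h₀ h
    have h' : a + m * l < n := lt_of_le_of_lt (by gcongr; omega) h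
    have hadj : G.Adj ⟨a + m * l, h'⟩ ⟨a + (m + 1) * l, h⟩ :=
      hG _ _ (ha.add (Dvd.intro_left m rfl)) (by simp only; ring)
    calc _ ≤ _ := G.edist_triangle (v := ⟨a + m * l, h'⟩)
      _ ≤ (m : ℕ∞) + 1 := add_le_add (ih h₀ h') (edist_eq_one_iff_adj.2 hadj).le
      _ = _ := by push_cast; rfl

theorem edist_mul_mul_le {n : ℕ} {G : SimpleGraph (Fin n)} {l : ℕ}
    (hG : ∀ x y : Fin n, l ∣ x → (x : ℕ) + l = y → G.Adj x y) (a b : ℕ) (ha : a * l < n)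
    (hb : b * l < n) : G.edist ⟨a * l, ha⟩ ⟨b * l, hb⟩ ≤ (Nat.dist a b : ℕ) := by
  wlog hab : a ≤ b generalizing a b
  · rw [edist_comm, Nat.dist_comm]
    exact this b a hb ha (by omega)
  obtain ⟨d, rfl⟩ := Nat.exists_eq_add_of_le hab
  have hd : Nat.dist a (a + d) = d := by simp [Nat.dist]
  have hb' : a * l + d * l < n := by rwa [← add_mul]
  rw [hd]
  convert edist_add_mul_le hG (Dvd.intro_left a rfl) d ha hb' using 3
  exact add_mul _ _ _

theorem edist_le_dist_of_path {n : ℕ} {G : SimpleGraph (Fin n)}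
    (hG : ∀ x y : Fin n, (x : ℕ) + 1 = y → G.Adj x y) (i j : Fin n) :
    G.edist i j ≤ (Nat.dist i j : ℕ) := by
  simpa using edist_mul_mul_le (l := 1) (fun x y _ h => hG x y h) i j (by simp) (by simp)

end SimpleGraph

theorem three_mul_sum_dist_add (n : ℕ) :
    3 * ∑ i : Fin n, ∑ j : Fin n, Nat.dist i j + n = n ^ 3 := by
  have gauss : ∀ m : ℕ, 2 * ∑ j : Fin m, Nat.dist j m = m * (m + 1) := by
    intro m
    induction m with
    | zero => simp
    | succ m ih =>
      have h : ∀ j : Fin m, Nat.dist j (m + 1) = Nat.dist j m + 1 := by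
        intro j; have := j.2; simp only [Nat.dist]; omega
      have h' : Nat.dist m (m + 1) = 1 := by simp [Nat.dist]
      rw [Fin.sum_univ_castSucc]
      simp only [Fin.val_castSucc, Fin.val_last, h, h', Finset.sum_add_distrib, mul_add, ih]
      simp
      ring
  induction n with
  | zero => simp
  | succ m ih =>
    rw [Fin.sum_univ_castSucc]
    simp only [Fin.sum_univ_castSucc, Fin.val_castSucc, Fin.val_last, Finset.sum_add_distrib,
      Nat.dist_self]
    have h := gauss m
    have h' : ∑ j : Fin m, Nat.dist m j = ∑ j : Fin m, Nat.dist j m :=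
      Finset.sum_congr rfl fun j _ => Nat.dist_comm _ _
    rw [h']
    linarith [show (m + 1) ^ 3 = m ^ 3 + 3 * (m * (m + 1)) + 1 by ring]

/-! ### The host graph and the path strategy -/

namespace NetworkCreation

theorem JointStrategy.ext_buys {V : Type*} {G : SimpleGraph V} {s t : JointStrategy G}
    (h : ∀ i, s.buys i = t.buys i) : s = t := by
  cases s; cases t; congr; exact funext h

/-- The path `0, 1, …, n - 1` together with chords joining consecutive multiples of `k`. -/
def chordedPath (n k : ℕ) : SimpleGraph (Fin n) :=
  SimpleGraph.fromRel fun i j => (i : ℕ) + 1 = j ∨ (k ∣ i ∧ (i : ℕ) + k = j)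

theorem chordedPath_adj {n k : ℕ} {i j : Fin n} : (chordedPath n k).Adj i j ↔ i ≠ j ∧
    (((i : ℕ) + 1 = j ∨ (k ∣ i ∧ (i : ℕ) + k = j)) ∨
      ((j : ℕ) + 1 = i ∨ (k ∣ j ∧ (j : ℕ) + k = i))) :=
  SimpleGraph.fromRel_adj _ _ _

theorem chordedPath_adj_succ {n k : ℕ} {i j : Fin n} (h : (i : ℕ) + 1 = j) :
    (chordedPath n k).Adj i j :=
  chordedPath_adj.2 ⟨by rintro rfl; omega, .inl (.inl h)⟩

theorem chordedPath_adj_add {n k : ℕ} (hk : 0 < k) {i j : Fin n} (hi : k ∣ i)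
    (h : (i : ℕ) + k = j) : (chordedPath n k).Adj i j :=
  chordedPath_adj.2 ⟨by rintro rfl; omega, .inl (.inr ⟨hi, h⟩)⟩

theorem chordedPath_adj_of_not_dvd {n k : ℕ} {i j : Fin n} (h : (chordedPath n k).Adj i j)
    (hi : ¬ k ∣ i) : (i : ℕ) + 1 = j ∨ (j : ℕ) + 1 = i := by
  rcases (chordedPath_adj.1 h).2 with (h | h) | (h | h)
  · exact .inl h
  · exact absurd h.1 hi
  · exact .inr h
  · exact absurd (h.2 ▸ h.1.add dvd_rfl) hi

theorem chordedPath_connected {n k : ℕ} (hn : 0 < n) : (chordedPath n k).Connected := by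
  have : Nonempty (Fin n) := ⟨⟨0, hn⟩⟩
  refine SimpleGraph.Connected.mk fun i j => SimpleGraph.edist_ne_top_iff_reachable.1 ?_
  exact ne_top_of_le_ne_top (ENat.natCast_ne_top _)
    (SimpleGraph.edist_le_dist_of_path (fun _ _ => chordedPath_adj_succ) i j)

/-- Walk down from each endpoint to the multiple of `k` below it, and join the two multiples by
chords. -/
theorem edist_chordedPath_le {n k : ℕ} (hk : 0 < k) (i j : Fin n) :
    (chordedPath n k).edist i j ≤ (2 * k + n / k : ℕ) := by
  have to_multiple : ∀ x : Fin n, ∃ h : x / k * k < n,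
      (chordedPath n k).edist x ⟨x / k * k, h⟩ ≤ (k : ℕ) := by
    intro x
    have h := Nat.div_mul_le_self x k
    have h' := Nat.lt_div_mul_add hk (a := x)
    refine ⟨h.trans_lt x.2,
      (SimpleGraph.edist_le_dist_of_path (fun _ _ => chordedPath_adj_succ) x _).trans ?_⟩
    simp only [Nat.dist, Nat.cast_le]
    omega
  obtain ⟨hi, hi'⟩ := to_multiple i
  obtain ⟨hj, hj'⟩ := to_multiple j
  have hij := SimpleGraph.edist_mul_mul_le (G := chordedPath n k)
    (fun x y => chordedPath_adj_add hk) _ _ hi hj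
  have hd : Nat.dist (i / k) (j / k) ≤ n / k := by
    have h₁ := Nat.div_le_div_right (c := k) i.2.le
    have h₂ := Nat.div_le_div_right (c := k) j.2.le
    generalize n / k = c, (i : ℕ) / k = a, (j : ℕ) / k = b at h₁ h₂
    simp only [Nat.dist]
    omega
  rw [SimpleGraph.edist_comm] at hj'
  calc _ ≤ _ := SimpleGraph.edist_triangle (v := ⟨i / k * k, hi⟩)
    _ ≤ (k : ℕ∞) + _ := add_le_add hi' (SimpleGraph.edist_triangle (v := ⟨j / k * k, hj⟩))
    _ ≤ (k : ℕ∞) + ((n / k : ℕ) + (k : ℕ∞)) := by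
      gcongr
      exact hij.trans (by exact_mod_cast hd)
    _ = _ := by push_cast; ring

/-- The strategy creating the path, in which multiples of `k` do not buy any link. -/
def pathStrategy (n k : ℕ) : JointStrategy (chordedPath n k) where
  buys i := {j | ((i : ℕ) + 1 = j ∨ (j : ℕ) + 1 = i) ∧ ¬ k ∣ i ∧ (k ∣ j ∨ i < j)}
  adj_of_mem i j h := by
    simp only [Finset.mem_filter, Finset.mem_univ, true_and] at h
    rcases h.1 with h | h
    exacts [chordedPath_adj_succ h, (chordedPath_adj_succ h).symm]

theorem mem_pathStrategy_buys {n k : ℕ} {i j : Fin n} : j ∈ (pathStrategy n k).buys i ↔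
    ((i : ℕ) + 1 = j ∨ (j : ℕ) + 1 = i) ∧ ¬ k ∣ i ∧ (k ∣ j ∨ i < j) := by
  simp [pathStrategy]

theorem pathStrategy_network_adj {n k : ℕ} (hk : 2 ≤ k) {i j : Fin n} :
    (pathStrategy n k).network.Adj i j ↔ (i : ℕ) + 1 = j ∨ (j : ℕ) + 1 = i := by
  have indep : ∀ a : ℕ, k ∣ a → ¬ k ∣ a + 1 := fun a h h' => by
    have := Nat.le_of_dvd one_pos ((Nat.dvd_add_right h).1 h')
    omega
  have hij : (i : ℕ) + 1 = j → k ∣ i → ¬ k ∣ j := fun h h' => h ▸ indep i h'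
  have hji : (j : ℕ) + 1 = i → k ∣ j → ¬ k ∣ i := fun h h' => h ▸ indep j h'
  change j ∈ (pathStrategy n k).buys i ∨ i ∈ (pathStrategy n k).buys j ↔ _
  simp only [mem_pathStrategy_buys, Fin.lt_def]
  constructor
  · rintro (h | h)
    exacts [h.1, h.1.symm]
  · intro h
    have hlt : (i : ℕ) < j ∨ (j : ℕ) < i := by omega
    tauto

theorem edist_pathStrategy {n k : ℕ} (hk : 2 ≤ k) (i j : Fin n) :
    (pathStrategy n k).network.edist i j = (Nat.dist i j : ℕ) := by
  refine le_antisymm (SimpleGraph.edist_le_dist_of_path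
    (fun x y h => (pathStrategy_network_adj hk).2 (.inl h)) i j) ?_
  refine SimpleGraph.le_edist_of_le_add_one (fun x : Fin n => ((Nat.dist i x : ℕ) : ℕ∞))
    (by simp) (fun x y h => ?_) j
  have := (pathStrategy_network_adj hk).1 h
  norm_cast
  simp only [Nat.dist]
  omega

theorem pathStrategy_network_connected {n k : ℕ} (hn : 0 < n) (hk : 2 ≤ k) :
    (pathStrategy n k).network.Connected := by
  have : Nonempty (Fin n) := ⟨⟨0, hn⟩⟩
  refine SimpleGraph.Connected.mk fun i j => SimpleGraph.edist_ne_top_iff_reachable.1 ?_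
  rw [edist_pathStrategy hk]
  exact ENat.natCast_ne_top _

/-! ### The path is an equilibrium -/

section Nash

variable {n k : ℕ} {α : ℝ} {i : Fin n} {t : JointStrategy (chordedPath n k)}

theorem network_adj_of_deviation (ht : ∀ j, j ≠ i → t.buys j = (pathStrategy n k).buys j)
    {x y : Fin n} (h : t.network.Adj x y) :
    ((x : ℕ) + 1 = y ∨ (y : ℕ) + 1 = x) ∨ (x = i ∧ y ∈ t.buys i) ∨ (y = i ∧ x ∈ t.buys i) := by
  have key : ∀ u v, v ∈ t.buys u → ((u : ℕ) + 1 = v ∨ (v : ℕ) + 1 = u) ∨ (u = i ∧ v ∈ t.buys i) := by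
    intro u v hv
    by_cases hu : u = i
    · exact .inr ⟨hu, hu ▸ hv⟩
    · rw [ht u hu] at hv
      exact .inl (mem_pathStrategy_buys.1 hv).1
  rcases h with h | h
  · have := key _ _ h; tauto
  · have := key _ _ h; tauto

theorem playerCost_le_of_subset (hk : 2 ≤ k)
    (hpath : ∀ x y, t.network.Adj x y → (x : ℕ) + 1 = y ∨ (y : ℕ) + 1 = x)
    (hsub : (pathStrategy n k).buys i ⊆ t.buys i) :
    (pathStrategy n k).playerCost α i ≤ t.playerCost α i := by
  have hle : t.network ≤ (pathStrategy n k).network :=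
    fun x y h => (pathStrategy_network_adj hk).2 (hpath x y h)
  unfold JointStrategy.playerCost
  gcongr

theorem playerCost_le_of_not_dvd (hk : 2 ≤ k)
    (ht : ∀ j, j ≠ i → t.buys j = (pathStrategy n k).buys j) (hi : ¬ k ∣ i) :
    (pathStrategy n k).playerCost α i ≤ t.playerCost α i := by
  have hpath : ∀ x y, t.network.Adj x y → (x : ℕ) + 1 = y ∨ (y : ℕ) + 1 = x := by
    intro x y h
    rcases network_adj_of_deviation ht h with h | ⟨rfl, h⟩ | ⟨rfl, h⟩
    · exact h
    · exact chordedPath_adj_of_not_dvd (t.adj_of_mem _ _ h) hi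
    · exact (chordedPath_adj_of_not_dvd (t.adj_of_mem _ _ h) hi).symm
  by_cases hsub : (pathStrategy n k).buys i ⊆ t.buys i
  · exact playerCost_le_of_subset hk hpath hsub
  obtain ⟨j, hj, hjt⟩ := Finset.not_subset.1 hsub
  have hj' := mem_pathStrategy_buys.1 hj
  -- No link is bought from both ends, so dropping `j` removes the link.
  have hcut : ¬ t.network.Adj i j := by
    rintro (h | h)
    · exact hjt h
    · have hji : j ≠ i := by rintro rfl; omega
      rw [ht j hji, mem_pathStrategy_buys, Fin.lt_def] at h
      rw [Fin.lt_def] at hj'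
      have := hj'.2.2.resolve_left h.2.1
      have := h.2.2.resolve_left hi
      omega
  have htop : t.network.edist i j = ⊤ := by
    rcases hj'.1 with hij | hij
    -- The potential is `⊤` beyond the cut and `0` on the side of `i`; only the removed link could
    -- cross.
    · have := SimpleGraph.le_edist_of_le_add_one (G := t.network)
        (fun x => if i < x then (⊤ : ℕ∞) else 0) (i := i) (by simp) (fun x y h => ?_) j
      · simpa [Fin.lt_def, ← hij] using this
      · by_cases hx : i < x
        · simp [hx]
        · have hy : ¬ i < y := fun hy => hcut <| by
            have := hpath x y h
            rw [Fin.lt_def] at hx hy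
            rwa [show i = x from Fin.ext (by omega), show j = y from Fin.ext (by omega)]
          simp [hy]
    · have := SimpleGraph.le_edist_of_le_add_one (G := t.network)
        (fun x => if x < i then (⊤ : ℕ∞) else 0) (i := i) (by simp) (fun x y h => ?_) j
      · simpa [Fin.lt_def, ← hij] using this
      · by_cases hx : x < i
        · simp [hx]
        · have hy : ¬ y < i := fun hy => hcut <| by
            have := hpath x y h
            rw [Fin.lt_def] at hx hy
            rwa [show i = x from Fin.ext (by omega), show j = y from Fin.ext (by omega)]
          simp [hy]
  have : t.playerCost α i = ⊤ := by
    unfold JointStrategy.playerCost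
    rw [ENNReal.add_eq_top]
    exact .inr (ENNReal.sum_eq_top.2 ⟨j, Finset.mem_univ _, by simp [htop]⟩)
  rw [this]
  exact le_top

/-- For `n ≤ k` no chord fits in the path, so the price condition is needed only when `k < n`. -/
theorem playerCost_le_of_dvd (hα : k < n → ((n * (k - 1) : ℕ) : ℝ) ≤ α) (hk : 2 ≤ k)
    (ht : ∀ j, j ≠ i → t.buys j = (pathStrategy n k).buys j) (hi : k ∣ i) :
    (pathStrategy n k).playerCost α i ≤ t.playerCost α i := by
  have hs : (pathStrategy n k).buys i = ∅ := by
    ext j; simp [mem_pathStrategy_buys, hi]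
  rcases (t.buys i).eq_empty_or_nonempty with hti | hti
  · have : t = pathStrategy n k := JointStrategy.ext_buys fun j => by
      by_cases hj : j = i
      · rw [hj, hti, hs]
      · exact ht j hj
    rw [this]
  have hlen : ∀ j ∈ t.buys i, (i : ℕ) + 1 = j ∨ (j : ℕ) + 1 = i ∨ (i : ℕ) + k = j ∨
      (j : ℕ) + k = i := fun j hj => by
    have := (chordedPath_adj.1 (t.adj_of_mem _ _ hj)).2
    tauto
  rcases le_or_gt n k with hnk | hnk
  · refine playerCost_le_of_subset hk (fun x y h => ?_) (by simp [hs])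
    rcases network_adj_of_deviation ht h with h | ⟨rfl, h⟩ | ⟨rfl, h⟩
    · exact h
    · have := hlen _ h; omega
    · have := hlen _ h; omega
  -- All new links meet `i`, where the truncated potential is `0`; it is at most `1` at the far end
  -- of a chord. Hence several chords together still save at most `k - 1` per vertex.
  have hdist : ∀ j : Fin n, ((Nat.dist i j - (k - 1) : ℕ) : ℕ∞) ≤ t.network.edist i j := by
    refine SimpleGraph.le_edist_of_le_add_one
      (fun j : Fin n => ((Nat.dist i j - (k - 1) : ℕ) : ℕ∞)) (by simp) fun x y h => ?_
    norm_cast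
    simp only [Nat.dist]
    rcases network_adj_of_deviation ht h with h | ⟨rfl, h⟩ | ⟨rfl, h⟩
    · omega
    · have := hlen _ h; omega
    · omega
  have hprice : ((n * (k - 1) : ℕ) : ℝ≥0∞) ≤ ENNReal.ofReal α * ((t.buys i).card : ℝ≥0∞) := by
    calc ((n * (k - 1) : ℕ) : ℝ≥0∞) = ENNReal.ofReal ((n * (k - 1) : ℕ) : ℝ) :=
          (ENNReal.ofReal_natCast _).symm
      _ ≤ ENNReal.ofReal α * 1 := by rw [mul_one]; exact ENNReal.ofReal_le_ofReal (hα hnk)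
      _ ≤ _ := by gcongr; exact_mod_cast hti.card_pos
  unfold JointStrategy.playerCost
  simp only [hs, Finset.card_empty, Nat.cast_zero, mul_zero, zero_add, edist_pathStrategy hk]
  calc ∑ j : Fin n, (((Nat.dist i j : ℕ) : ℕ∞) : ℝ≥0∞)
      ≤ ∑ j : Fin n, (((k - 1 : ℕ) : ℝ≥0∞) + ((Nat.dist i j - (k - 1) : ℕ) : ℝ≥0∞)) := by
        refine Finset.sum_le_sum fun j _ => ?_
        have h : Nat.dist i j ≤ (k - 1) + (Nat.dist i j - (k - 1)) := by omega
        exact_mod_cast (Nat.cast_le (α := ℝ≥0∞)).2 h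
    _ = ((n * (k - 1) : ℕ) : ℝ≥0∞) + ∑ j : Fin n, ((Nat.dist i j - (k - 1) : ℕ) : ℝ≥0∞) := by
        simp [Finset.sum_add_distrib]
    _ ≤ _ := by
        refine add_le_add hprice (Finset.sum_le_sum fun j _ => ?_)
        have := ENat.toENNReal_le.2 (hdist j)
        simpa using this

theorem pathStrategy_isNash (hα : k < n → ((n * (k - 1) : ℕ) : ℝ) ≤ α) (hk : 2 ≤ k) :
    (pathStrategy n k).IsNash α := fun i _ ht => by
  by_cases hi : k ∣ i
  · exact playerCost_le_of_dvd hα hk ht hi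
  · exact playerCost_le_of_not_dvd hk ht hi

end Nash

/-! ### Cost of the path against the social optimum -/

theorem le_totalCost_pathStrategy {n k : ℕ} (α : ℝ) (hn : 2 ≤ n) (hk : 2 ≤ k) :
    ENNReal.ofReal ((n : ℝ) ^ 3 / 4) ≤ (pathStrategy n k).totalCost α := by
  have hsum : (n : ℝ) ^ 3 / 4 ≤ ((∑ i : Fin n, ∑ j : Fin n, Nat.dist i j : ℕ) : ℝ) := by
    have h : (3 * ((∑ i : Fin n, ∑ j : Fin n, Nat.dist i j : ℕ) : ℝ) + n) = (n : ℝ) ^ 3 := by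
      exact_mod_cast three_mul_sum_dist_add n
    have hn' : (2 : ℝ) ≤ n := by exact_mod_cast hn
    nlinarith [mul_nonneg (by linarith : (0 : ℝ) ≤ n)
      (mul_nonneg (by linarith : (0 : ℝ) ≤ n - 2) (by linarith : (0 : ℝ) ≤ n + 2))]
  calc _ ≤ ENNReal.ofReal ((∑ i : Fin n, ∑ j : Fin n, Nat.dist i j : ℕ) : ℝ) :=
        ENNReal.ofReal_le_ofReal hsum
    _ = ∑ i : Fin n, ∑ j : Fin n, ((Nat.dist i j : ℕ) : ℝ≥0∞) := by
        rw [ENNReal.ofReal_natCast]; push_cast; rfl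
    _ ≤ _ := by
        refine Finset.sum_le_sum fun i _ => ?_
        unfold JointStrategy.playerCost
        simp only [edist_pathStrategy hk, ENat.toENNReal_coe]
        exact le_add_self

open scoped Classical in
/-- The strategy creating the whole host graph, in which the smaller endpoint buys each link. -/
noncomputable def buyAll {n : ℕ} (G : SimpleGraph (Fin n)) : JointStrategy G where
  buys i := {j | G.Adj i j ∧ i < j}
  adj_of_mem i j h := by
    simp only [Finset.mem_filter, Finset.mem_univ, true_and] at h
    exact h.1

theorem buyAll_network {n : ℕ} (G : SimpleGraph (Fin n)) : (buyAll G).network = G := by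
  ext i j
  refine ⟨fun h => h.elim ((buyAll G).adj_of_mem i j) fun h => ((buyAll G).adj_of_mem j i h).symm,
    fun h => ?_⟩
  change j ∈ (buyAll G).buys i ∨ i ∈ (buyAll G).buys j
  rcases lt_or_gt_of_ne h.ne with hij | hij
  · left; simp [buyAll, h, hij]
  · right; simp [buyAll, h.symm, hij]

theorem card_buyAll_chordedPath_le {n k : ℕ} (i : Fin n) :
    ((buyAll (chordedPath n k)).buys i).card ≤ 2 := by
  calc _ = (((buyAll (chordedPath n k)).buys i).image Fin.val).card :=
        (Finset.card_image_of_injective _ Fin.val_injective).symm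
    _ ≤ ({(i : ℕ) + 1, (i : ℕ) + k} : Finset ℕ).card := by
        refine Finset.card_le_card fun x hx => ?_
        obtain ⟨j, hj, rfl⟩ := Finset.mem_image.1 hx
        simp only [buyAll, Finset.mem_filter, Finset.mem_univ, true_and, Fin.lt_def,
          chordedPath_adj] at hj
        simp only [Finset.mem_insert, Finset.mem_singleton]
        omega
    _ ≤ 2 := Finset.card_le_two

theorem socialOptimum_chordedPath_le {n k : ℕ} {α : ℝ} (hα : 0 < α) (hk : 0 < k) :
    socialOptimum α (chordedPath n k) ≤
      ENNReal.ofReal (n * (α * 2 + n * (2 * k + (n : ℝ) / k))) := by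
  refine (iInf_le _ (buyAll (chordedPath n k))).trans ?_
  have hplayer : ∀ i, (buyAll (chordedPath n k)).playerCost α i ≤
      ENNReal.ofReal (α * 2 + n * (2 * k + (n : ℝ) / k)) := by
    intro i
    unfold JointStrategy.playerCost
    rw [buyAll_network, ENNReal.ofReal_add (by positivity) (by positivity),
      ENNReal.ofReal_mul hα.le, ENNReal.ofReal_mul (by positivity), ENNReal.ofReal_natCast]
    gcongr
    · rw [ENNReal.ofReal_ofNat]
      exact_mod_cast card_buyAll_chordedPath_le i
    · calc _ ≤ ∑ _j : Fin n, ENNReal.ofReal (2 * k + (n : ℝ) / k) := by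
            refine Finset.sum_le_sum fun j _ => ?_
            have h := ENat.toENNReal_le.2 (edist_chordedPath_le hk i j)
            rw [ENat.toENNReal_coe, ← ENNReal.ofReal_natCast] at h
            refine h.trans (ENNReal.ofReal_le_ofReal ?_)
            push_cast
            gcongr
            exact Nat.cast_div_le
        _ = _ := by simp
  calc _ ≤ ∑ _i : Fin n, ENNReal.ofReal (α * 2 + n * (2 * k + (n : ℝ) / k)) :=
        Finset.sum_le_sum fun i _ => hplayer i
    _ = _ := by
        rw [ENNReal.ofReal_mul (by positivity), ENNReal.ofReal_natCast]
        simp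

theorem le_priceOfAnarchy {V : Type*} [Fintype V] {G : SimpleGraph V} {α : ℝ} {r : ℝ≥0∞}
    {s : JointStrategy G} (hs : s.IsNash α) (hc : s.network.Connected)
    (h₀ : s.totalCost α ≠ 0) (h : socialOptimum α G ≠ ∞)
    (hr : r * socialOptimum α G ≤ s.totalCost α) : r ≤ priceOfAnarchy α G :=
  ((ENNReal.le_div_iff_mul_le (.inr h₀) (.inl h)).2 hr).trans
    (le_iSup_of_le s (le_iSup_of_le hs (le_iSup_of_le hc le_rfl)))

end NetworkCreation

/-! ### Choice of `k` and the final estimate -/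

theorem mainTheorem10 :
    ∃ c : ℝ, 0 < c ∧ ∀ n : ℕ, 2 ≤ n → ∀ α : ℝ, 0 < α →
      ∃ G : SimpleGraph (Fin n), G.Connected ∧
        ENNReal.ofReal (c * min (α / (n : ℝ)) ((n : ℝ) ^ 2 / α)) ≤
          NetworkCreation.priceOfAnarchy α G := by
  open NetworkCreation in
  -- `28 = 4 · (6 + 1)`: path cost `n³/4` against the optimum bound `6αn + n⁴/α`.
  refine ⟨1 / 28, by norm_num, fun n hn α hα => ?_⟩
  have hn₀ : (0 : ℝ) < n := by exact_mod_cast (by omega : 0 < n)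
  have hcost : ∀ k, 2 ≤ k → (pathStrategy n k).totalCost α ≠ 0 := fun k hk =>
    ((ENNReal.ofReal_pos.2 (by positivity)).trans_le (le_totalCost_pathStrategy α hn hk)).ne'
  have hopt : ∀ k, 2 ≤ k → socialOptimum α (chordedPath n k) ≠ ⊤ := fun k hk =>
    ne_top_of_le_ne_top ENNReal.ofReal_ne_top (socialOptimum_chordedPath_le hα (by omega))
  rcases lt_or_ge α n with hαn | hαn
  -- With `k = n` there are no chords, and a ratio of 1 is enough.
  · refine ⟨chordedPath n n, chordedPath_connected (by omega), ?_⟩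
    refine le_priceOfAnarchy (pathStrategy_isNash (fun h => absurd h (lt_irrefl _)) hn)
      (pathStrategy_network_connected (by omega) hn) (hcost n hn) (hopt n hn) ?_
    have hle : 1 / 28 * min (α / (n : ℝ)) ((n : ℝ) ^ 2 / α) ≤ 1 := by
      have h := (min_le_left (α / (n : ℝ)) ((n : ℝ) ^ 2 / α)).trans ((div_le_one hn₀).2 hαn.le)
      linarith
    calc _ ≤ 1 * socialOptimum α (chordedPath n n) := by
          gcongr
          exact ENNReal.ofReal_le_one.2 hle
      _ ≤ _ := by rw [one_mul]; exact iInf_le _ _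
  · set q := ⌊α / n⌋₊ with hq
    have hαn' : 1 ≤ α / n := (one_le_div hn₀).2 hαn
    have hq₁ : 1 ≤ q := Nat.one_le_floor_iff _ |>.2 hαn'
    have hqle : (q : ℝ) ≤ α / n := Nat.floor_le (by positivity)
    have hqlt : α / n < q + 1 := Nat.lt_floor_add_one _
    have hk : 2 ≤ q + 1 := by omega
    refine ⟨chordedPath n (q + 1), chordedPath_connected (by omega), ?_⟩
    refine le_priceOfAnarchy (pathStrategy_isNash (fun _ => ?_) hk)
      (pathStrategy_network_connected (by omega) hk) (hcost _ hk) (hopt _ hk) ?_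
    · rw [Nat.add_sub_cancel, Nat.cast_mul, mul_comm]
      exact (le_div_iff₀ hn₀).1 hqle
    set m := min (α / (n : ℝ)) ((n : ℝ) ^ 2 / α) with hm
    have hm₀ : 0 ≤ m := le_min (by positivity) (by positivity)
    -- Since `α/n ≥ 1`, the value `k = q + 1` lies between `α/n` and `2α/n`.
    have hbound : n * (α * 2 + n * (2 * ((q + 1 : ℕ) : ℝ) + n / ((q + 1 : ℕ) : ℝ))) ≤
        6 * α * n + (n : ℝ) ^ 4 / α := by
      have h₁ : ((q + 1 : ℕ) : ℝ) ≤ 2 * (α / n) := by push_cast; linarith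
      have h₂ : (n : ℝ) / ((q + 1 : ℕ) : ℝ) ≤ n / (α / n) := by
        gcongr
        push_cast
        exact hqlt.le
      calc _ ≤ n * (α * 2 + n * (2 * (2 * (α / n)) + n / (α / n))) := by gcongr
        _ = _ := by field_simp; ring
    have hreal : 1 / 28 * m * (6 * α * n + (n : ℝ) ^ 4 / α) ≤ (n : ℝ) ^ 3 / 4 := by
      have h₁ : m * (α * n) ≤ (n : ℝ) ^ 3 :=
        calc m * (α * n) ≤ (n : ℝ) ^ 2 / α * (α * n) := by gcongr; exact min_le_right _ _
          _ = _ := by field_simp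
      have h₂ : m * ((n : ℝ) ^ 4 / α) ≤ (n : ℝ) ^ 3 :=
        calc m * ((n : ℝ) ^ 4 / α) ≤ α / n * ((n : ℝ) ^ 4 / α) := by gcongr; exact min_le_left _ _
          _ = _ := by field_simp
      linarith
    calc _ ≤ ENNReal.ofReal (1 / 28 * m) * ENNReal.ofReal (6 * α * n + (n : ℝ) ^ 4 / α) := by
          gcongr
          exact (socialOptimum_chordedPath_le hα (by omega)).trans
            (ENNReal.ofReal_le_ofReal hbound)
      _ = ENNReal.ofReal (1 / 28 * m * (6 * α * n + (n : ℝ) ^ 4 / α)) :=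
          (ENNReal.ofReal_mul (by positivity)).symm
      _ ≤ ENNReal.ofReal ((n : ℝ) ^ 3 / 4) := ENNReal.ofReal_le_ofReal hreal
      _ ≤ _ := le_totalCost_pathStrategy α hn hk
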